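/- An approach space is a set $X$ with a function $\delta:PX\times X\to[0,\infty]$ such that, for all $A,B\subseteq X$, $x\in X$ and $\varepsilon\in[0,\infty]$: $\delta(\{x\},x)=0$; $\delta(\varnothing,x)=\infty$; $\delta(A\cup B,x)=\min\{\delta(A,x),\delta(B,x)\}$; and $\delta(\{y\in X\mid\delta(A,y)\le\varepsilon\},x)+\varepsilon\ge\delta(A,x)$. A map $f:(X,\delta)\to(Y,\delta')$ is a contraction if $\delta(A,x)\ge\delta'(f(A),f(x))$ for all $A\subseteq X$ and $x\in X$. Let $\mathbf{App}$ be the category of approach spaces and contractions. An approach space $X$ is exponentiable if the cartesian product functor $(-)\times X:\mathbf{App}\to\mathbf{App}$ has a right adjoint. Write $UX$ for the set of ultrafilters on $X$ and let $m_X:UUX\to UX$, $m_X(\mathfrak X)=\{A\subseteq X\mid\{\mathfrak a\in UX\mid A\in\mathfrak a\}\in\mathfrak X\}$. The ultrafilter convergence of an approach space $(X,\delta)$ is $a:UX\times X\to[0,\infty]$, $a(\mathfrak x,x)=\sup_{A\in\mathfrak x}\delta(A,x)$, and for $\mathfrak X\in UUX$, $\mathfrak x\in UX$ put $$\overline U a(\mathfrak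 X,\mathfrak x)=\sup_{\mathcal A\in\mathfrak X,\,B\in\mathfrak x}\ \inf_{\mathfrak a\in\mathcal A,\,x\in B}a(\mathfrak a,x).$$ Write $u\vee v$ for the maximum of $u$ and $v$. **Theorem.** Let $X$ be an approach space with ultrafilter convergence $a$. Then $X$ is exponentiable in $\mathbf{App}$ if and only if, for all $\mathfrak X\in UUX$, $x_0\in X$ and $u,v\in[0,\infty]$, $$(u+v)\vee a(m_X(\mathfrak X),x_0)\ \ge\ \inf_{\mathfrak x\in UX}\Big(\big(u\vee a(\mathfrak x,x_0)\big)+\big(v\vee\overline U a(\mathfrak X,\mathfrak x)\big)\Big).$$ -/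

import Mathlib

open CategoryTheory Limits
open scoped ENNReal

universe w

/-- An approach space: a set `X` with an approach distance `δ : PX × X → [0,∞]`. -/
class ApproachSpace (X : Type w) where
  /-- the approach distance -/
  δ : Set X → X → ℝ≥0∞
  δ_singleton : ∀ x, δ {x} x = 0
  δ_empty : ∀ x, δ ∅ x = ∞
  δ_union : ∀ A B x, δ (A ∪ B) x = min (δ A x) (δ B x)
  δ_enlarge : ∀ (A : Set X) (x : X) (ε : ℝ≥0∞), δ A x ≤ δ {y | δ A y ≤ ε} x + ε

namespace ApproachSpace

/-- A map `f` is a contraction if `δ (A, x) ≥ δ' (f(A), f(x))` for all `A`, `x`. -/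
def IsContraction {X Y : Type w} [ApproachSpace X] [ApproachSpace Y] (f : X → Y) : Prop :=
  ∀ (A : Set X) (x : X), δ (f '' A) (f x) ≤ δ A x

/-- The ultrafilter convergence of an approach space: `a (𝔵, x) = sup_{A ∈ 𝔵} δ (A, x)`. -/
noncomputable def conv {X : Type w} [ApproachSpace X] (𝔵 : Ultrafilter X) (x : X) : ℝ≥0∞ :=
  ⨆ A ∈ 𝔵, δ A x

/-- The extension of the ultrafilter functor to numerical relations:
`Ū r (𝔵, 𝔶) = sup_{A ∈ 𝔵, B ∈ 𝔶} inf_{x ∈ A, y ∈ B} r (x, y)`. -/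
noncomputable def ultraExt {X Y : Type w} (r : X → Y → ℝ≥0∞)
    (𝔵 : Ultrafilter X) (𝔶 : Ultrafilter Y) : ℝ≥0∞ :=
  ⨆ A ∈ 𝔵, ⨆ B ∈ 𝔶, ⨅ x ∈ A, ⨅ y ∈ B, r x y

/-- The multiplication `m_X : UUX → UX` of the ultrafilter monad. -/
def ultraMul {X : Type w} (𝔛 : Ultrafilter (Ultrafilter X)) : Ultrafilter X :=
  𝔛.bind id

theorem mem_ultraMul {X : Type w} {𝔛 : Ultrafilter (Ultrafilter X)} {A : Set X} :
    A ∈ ultraMul 𝔛 ↔ {𝔞 : Ultrafilter X | A ∈ 𝔞} ∈ 𝔛 :=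
  Iff.rfl

section Basic

variable {X Y Z : Type w} [ApproachSpace X] [ApproachSpace Y] [ApproachSpace Z]

theorem δ_mono {A B : Set X} (h : A ⊆ B) (x : X) : δ B x ≤ δ A x := by
  have := δ_union A B x
  rw [Set.union_eq_self_of_subset_left h] at this
  rw [this]
  exact min_le_left _ _

theorem δ_of_mem {A : Set X} {x : X} (h : x ∈ A) : δ A x = 0 :=
  le_antisymm ((δ_mono (Set.singleton_subset_iff.2 h) x).trans (δ_singleton x).le) bot_le

theorem le_δ_of_cover (F : Finset (Set X)) (A : Set X) (hA : A ⊆ ⋃ B ∈ F, B) (x : X) :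
    ⨅ B ∈ F, δ (A ∩ B) x ≤ δ A x := by
  classical
  induction F using Finset.induction_on generalizing A with
  | empty =>
    have : A = ∅ := by simpa using hA
    simp [this, δ_empty]
  | insert B F _ ih =>
    have h1 : A = (A ∩ B) ∪ (A ∩ ⋃ C ∈ F, C) := by
      rw [← Set.inter_union_distrib_left]
      refine (Set.inter_eq_left.2 ?_).symm
      simpa using hA
    conv_rhs => rw [h1, δ_union]
    rw [Finset.iInf_insert]
    refine le_min inf_le_left (inf_le_right.trans ?_)
    refine le_trans ?_ (ih _ Set.inter_subset_right)
    exact iInf₂_mono fun C _ =>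
      δ_mono (Set.inter_subset_inter_left _ Set.inter_subset_left) x

theorem isContraction_id : IsContraction (id : X → X) := fun A x => by simp

theorem IsContraction.comp {g : Y → Z} {f : X → Y} (hg : IsContraction g)
    (hf : IsContraction f) : IsContraction (g ∘ f) := fun A x => by
  rw [Set.image_comp]
  exact (hg _ _).trans (hf _ _)

/-- The product approach distance on `X × Y`: the supremum, over all finite covers of `A`, of
`min_B max (δ (π₁ B, x), δ (π₂ B, y))`, where `B` runs through the cover. That this is the
product in the category of approach spaces is shown in `AppCat.prodIsLimit`. -/
noncomputable def prodδ (A : Set (X × Y)) (p : X × Y) : ℝ≥0∞ :=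
  ⨆ (F : Finset (Set (X × Y))) (_ : A ⊆ ⋃ B ∈ F, B),
    ⨅ B ∈ F, max (δ (Prod.fst '' B) p.1) (δ (Prod.snd '' B) p.2)

theorem prodδ_mono {A A' : Set (X × Y)} (h : A ⊆ A') (p : X × Y) :
    prodδ A' p ≤ prodδ A p :=
  iSup_mono fun _ => iSup_le fun hF => le_iSup_of_le (h.trans hF) le_rfl

noncomputable instance prod : ApproachSpace (X × Y) where
  δ := prodδ
  δ_singleton p := by
    refine le_antisymm (iSup₂_le fun F hF => ?_) bot_le
    obtain ⟨B, hB, hp⟩ : ∃ B ∈ F, p ∈ B := by simpa using hF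
    refine (iInf₂_le B hB).trans ?_
    rw [δ_of_mem (Set.mem_image_of_mem _ hp), δ_of_mem (Set.mem_image_of_mem _ hp)]
    simp
  δ_empty p := by
    refine top_unique (le_iSup₂_of_le ∅ (by simp) (by simp))
  δ_union A A' p := by
    classical
    refine le_antisymm (le_min (prodδ_mono Set.subset_union_left p)
      (prodδ_mono Set.subset_union_right p)) ?_
    rw [prodδ, prodδ]
    rw [iSup₂_inf_eq]
    refine iSup₂_le fun F hF => ?_
    rw [inf_iSup₂_eq]
    refine iSup₂_le fun G hG => ?_
    refine le_iSup₂_of_le (F ∪ G) ?_ ?_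
    · rw [Finset.set_biUnion_union]
      exact Set.union_subset_union hF hG
    · rw [Finset.iInf_union]
  δ_enlarge A p ε := by
    classical
    refine iSup₂_le fun F hF => ?_
    let E : Set (X × Y) → Set (X × Y) := fun B =>
      {q | max (δ (Prod.fst '' B) q.1) (δ (Prod.snd '' B) q.2) ≤ ε}
    by_cases hε : ε = ∞
    · simp [hε]
    have hcov : {q | prodδ A q ≤ ε} ⊆ ⋃ B ∈ F.image E, B := by
      intro q hq
      have h1 : ⨅ B ∈ F, max (δ (Prod.fst '' B) q.1) (δ (Prod.snd '' B) q.2) ≤ ε :=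
        (le_iSup₂ (f := fun (F : Finset (Set (X × Y))) (_ : A ⊆ ⋃ B ∈ F, B) =>
          ⨅ B ∈ F, max (δ (Prod.fst '' B) q.1) (δ (Prod.snd '' B) q.2)) F hF).trans hq
      have hne : F.Nonempty := by
        rw [Finset.nonempty_iff_ne_empty]
        rintro rfl
        simp [hε] at h1
      rw [← Finset.inf_eq_iInf] at h1
      obtain ⟨B, hB, hBe⟩ := Finset.exists_mem_eq_inf F hne
        (fun B => max (δ (Prod.fst '' B) q.1) (δ (Prod.snd '' B) q.2))
      rw [hBe] at h1
      simp only [Finset.mem_image, Set.mem_iUnion]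
      exact ⟨E B, ⟨B, hB, rfl⟩, h1⟩
    refine le_trans ?_ (add_le_add_left (le_iSup₂_of_le (F.image E) hcov le_rfl) ε)
    rw [ENNReal.iInf_add]
    refine le_iInf fun C => ?_
    by_cases hC : C ∈ F.image E
    · obtain ⟨B, hB, rfl⟩ := Finset.mem_image.1 hC
      simp only [hC, iInf_pos]
      refine (iInf₂_le B hB).trans (max_le ?_ ?_)
      · refine (δ_enlarge _ _ ε).trans (add_le_add_left ((δ_mono ?_ _).trans (le_max_left _ _)) ε)
        rintro _ ⟨q, hq, rfl⟩
        exact (le_max_left (δ (Prod.fst '' B) q.1) (δ (Prod.snd '' B) q.2)).trans hq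
      · refine (δ_enlarge _ _ ε).trans (add_le_add_left ((δ_mono ?_ _).trans (le_max_right _ _)) ε)
        rintro _ ⟨q, hq, rfl⟩
        exact (le_max_right (δ (Prod.fst '' B) q.1) (δ (Prod.snd '' B) q.2)).trans hq
    · simp [hC]

theorem isContraction_fst : IsContraction (Prod.fst : X × Y → X) := fun A p =>
  le_iSup₂_of_le {A} (by simp) (by simp)

theorem isContraction_snd : IsContraction (Prod.snd : X × Y → Y) := fun A p =>
  le_iSup₂_of_le {A} (by simp) (by simp)

theorem IsContraction.prodMk {f : Z → X} {g : Z → Y} (hf : IsContraction f)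
    (hg : IsContraction g) : IsContraction (fun z => (f z, g z)) := fun A z => by
  classical
  refine iSup₂_le fun F hF => ?_
  let h : Z → X × Y := fun z => (f z, g z)
  have hcov : A ⊆ ⋃ C ∈ F.image (fun B => h ⁻¹' B), C := by
    intro a ha
    obtain ⟨B, hB, haB⟩ : ∃ B ∈ F, h a ∈ B := by simpa using hF (Set.mem_image_of_mem h ha)
    simp only [Finset.mem_image, Set.mem_iUnion]
    exact ⟨_, ⟨B, hB, rfl⟩, haB⟩
  refine le_trans ?_ (le_δ_of_cover _ A hcov z)
  refine le_iInf₂ fun C hC => ?_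
  obtain ⟨B, hB, rfl⟩ := Finset.mem_image.1 hC
  refine (iInf₂_le B hB).trans (max_le ?_ ?_)
  · refine (δ_mono ?_ _).trans (hf _ z)
    rintro _ ⟨c, hc, rfl⟩
    exact ⟨h c, hc.2, rfl⟩
  · refine (δ_mono ?_ _).trans (hg _ z)
    rintro _ ⟨c, hc, rfl⟩
    exact ⟨h c, hc.2, rfl⟩

end Basic

end ApproachSpace

open ApproachSpace

/-- The category of approach spaces and contractions: its objects. -/
structure AppCat where
  /-- bundle an approach space -/
  of ::
  /-- the underlying set -/
  carrier : Type w
  [str : ApproachSpace carrier]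

attribute [instance] AppCat.str

namespace AppCat

/-- The morphisms of the category of approach spaces: contractions. -/
@[ext]
structure Hom (X Y : AppCat.{w}) where
  /-- the underlying map -/
  toFun : X.carrier → Y.carrier
  contraction : IsContraction toFun

instance : Category AppCat.{w} where
  Hom := Hom
  id _ := ⟨id, isContraction_id⟩
  comp f g := ⟨g.toFun ∘ f.toFun, g.contraction.comp f.contraction⟩

@[ext]
theorem hom_ext {X Y : AppCat.{w}} {f g : X ⟶ Y} (h : ∀ x, f.toFun x = g.toFun x) : f = g :=
  Hom.ext (funext h)

/-- The cartesian product of two approach spaces. -/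
noncomputable def prod (Y X : AppCat.{w}) : AppCat.{w} := of (Y.carrier × X.carrier)

/-- The first projection. -/
noncomputable def fst (Y X : AppCat.{w}) : prod Y X ⟶ Y := ⟨Prod.fst, isContraction_fst⟩

/-- The second projection. -/
noncomputable def snd (Y X : AppCat.{w}) : prod Y X ⟶ X := ⟨Prod.snd, isContraction_snd⟩

/-- `prod Y X`, with its projections, is the categorical product of `Y` and `X`. -/
noncomputable def prodIsLimit (Y X : AppCat.{w}) : IsLimit (BinaryFan.mk (fst Y X) (snd Y X)) :=
  BinaryFan.isLimitMk
    (fun s => ⟨fun z => (s.fst.toFun z, s.snd.toFun z),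
      s.fst.contraction.prodMk s.snd.contraction⟩)
    (fun _ => rfl) (fun _ => rfl)
    (fun _ _ h₁ h₂ => hom_ext fun z => Prod.ext
      (congrFun (congrArg Hom.toFun h₁) z) (congrFun (congrArg Hom.toFun h₂) z))

/-- The functor `(-) × X : App ⥤ App`. -/
noncomputable def prodFunctor (X : AppCat.{w}) : AppCat.{w} ⥤ AppCat.{w} where
  obj Y := prod Y X
  map f := ⟨fun p => (f.toFun p.1, p.2),
    (f.contraction.comp isContraction_fst).prodMk isContraction_snd⟩

/-- `X` is exponentiable if the functor `(-) × X` has a right adjoint. -/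
def IsExponentiable (X : AppCat.{w}) : Prop := (prodFunctor X).IsLeftAdjoint

end AppCat

/-!
An exponential of `Y` by `X` has to be carried by the set of contractions `X → Y`, and its
convergence can only be the coarsest one, `expConv`, making evaluation a contraction. It is always
reflexive, so `X` is exponentiable if and only if `expConv` is transitive for every `Y`.

If the inequality holds, an ultrafilter of ultrafilters of graph points is compared with the
ultrafilters `𝔵` over which the infimum ranges, and the transitivity of the convergence of `Y`
passes to `expConv`. Conversely, take `Y = [0,∞]` and the functions `y ↦ a (x, y)`,
`y ↦ v ∨ a (𝔞, y)` and `y ↦ inf_𝔵 ((u ∨ a (𝔵, y)) + (v ∨ Ū a (𝔛, 𝔵)))`. The ultrafilter `𝔞`, read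
as an ultrafilter of functions of the first kind, is within `v` of the second function, and `𝔛`,
read as an ultrafilter of functions of the second kind, is within `u` of the third. Transitivity
puts `m_X (𝔛)` within `u + v` of the third function. Evaluating along the diagonal, where
`a (x, x) = 0`, bounds its value at `x₀` by `(u + v) ∨ a (m_X (𝔛), x₀)`.
-/

namespace ApproachSpace

theorem le_add_of_forall_right_lt {a b c : ℝ≥0∞} (h : ∀ t, b < t → c ≤ a + t) : c ≤ a + b := by
  refine ENNReal.le_of_forall_pos_le_add fun ε hε hfin => ?_
  rw [add_assoc]
  exact h _ (ENNReal.lt_add_right (ne_top_of_le_ne_top hfin.ne le_add_self)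
    (ENNReal.coe_ne_zero.2 hε.ne'))

section Ultrafilters

variable {S T X Y : Type*}

theorem ultrafilter_map_eq_of_le {f : S → T} {𝔰 : Ultrafilter S} {𝔱 : Ultrafilter T}
    (h : Filter.map f 𝔰 ≤ 𝔱) : 𝔰.map f = 𝔱 :=
  Ultrafilter.coe_le_coe.1 h

theorem exists_coupling {𝔵 : Ultrafilter X} {𝔶 : Ultrafilter Y} {p : X × Y → Prop}
    (h : ∃ᶠ z in (𝔵 : Filter X) ×ˢ (𝔶 : Filter Y), p z) :
    ∃ 𝔴 : Ultrafilter (X × Y), 𝔴.map Prod.fst = 𝔵 ∧ 𝔴.map Prod.snd = 𝔶 ∧ ∀ᶠ z in 𝔴, p z := by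
  have := Filter.frequently_iff_neBot.1 h
  obtain ⟨𝔴, h𝔴⟩ :=
    Ultrafilter.exists_le ((𝔵 : Filter X) ×ˢ (𝔶 : Filter Y) ⊓ Filter.principal {z | p z})
  have hprod := h𝔴.trans inf_le_left
  exact ⟨𝔴, ultrafilter_map_eq_of_le (Filter.tendsto_fst.mono_left hprod),
    ultrafilter_map_eq_of_le (Filter.tendsto_snd.mono_left hprod),
    Filter.le_principal_iff.1 (h𝔴.trans inf_le_right)⟩

theorem exists_coupling_of_map_eq {f : X → T} {g : Y → T} {𝔵 : Ultrafilter X} {𝔶 : Ultrafilter Y}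
    (h : 𝔵.map f = 𝔶.map g) :
    ∃ 𝔴 : Ultrafilter (X × Y), 𝔴.map Prod.fst = 𝔵 ∧ 𝔴.map Prod.snd = 𝔶 ∧
      ∀ᶠ z : X × Y in 𝔴, f z.1 = g z.2 := by
  refine exists_coupling (Filter.frequently_iff.2 fun {U} hU => ?_)
  obtain ⟨A, hA, B, hB, hAB⟩ := Filter.mem_prod_iff.1 hU
  have hfA : f '' A ∈ 𝔶.map g := h ▸ Filter.image_mem_map hA
  obtain ⟨y, ⟨x, hx, hxy⟩, hy⟩ := 𝔶.nonempty_of_mem (Filter.inter_mem hfA hB)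
  exact ⟨(x, y), hAB ⟨hx, hy⟩, hxy⟩

theorem map_eq_of_map_fst_eq_pure {𝔴 : Ultrafilter (S × X)} {s : S} (h : 𝔴.map Prod.fst = pure s)
    (f : S × X → Y) : 𝔴.map f = (𝔴.map Prod.snd).map fun x => f (s, x) := by
  have hs : ∀ᶠ p in (𝔴 : Filter (S × X)), p.1 = s := by
    have : {s} ∈ 𝔴.map Prod.fst := h ▸ Set.mem_singleton s
    exact this
  refine Ultrafilter.coe_injective (Filter.map_congr (hs.mono fun p hp => ?_))
  subst hp
  rfl

end Ultrafilters

section UltraMul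

variable {X Y : Type w}

theorem ultraMul_map (f : X → Y) (𝔛 : Ultrafilter (Ultrafilter X)) :
    ultraMul (𝔛.map (Ultrafilter.map f)) = (ultraMul 𝔛).map f :=
  rfl

theorem ultraMul_map_const {S : Type*} (𝔰 : Ultrafilter S) (𝔵 : Ultrafilter X) :
    ultraMul (𝔰.map fun _ => 𝔵) = 𝔵 :=
  Ultrafilter.ext fun _ => Filter.eventually_const (f := (𝔰 : Filter S))

theorem exists_le_ultraMul_eq {𝓕 : Filter (Ultrafilter X)} {𝔵 : Ultrafilter X}
    (h : ∀ A ∈ 𝔵, ∃ᶠ 𝔶 in 𝓕, A ∈ 𝔶) :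
    ∃ 𝔛 : Ultrafilter (Ultrafilter X), (𝔛 : Filter (Ultrafilter X)) ≤ 𝓕 ∧ ultraMul 𝔛 = 𝔵 := by
  let g : Set X → Set (Ultrafilter X) := fun A => {𝔶 | A ∈ 𝔶}
  have hg : Monotone g := fun A B hAB 𝔶 hA => Filter.mem_of_superset hA hAB
  have hne : (𝓕 ⊓ (𝔵 : Filter X).lift' g).NeBot := by
    refine Filter.inf_neBot_iff.2 fun {U} hU {V} hV => ?_
    obtain ⟨A, hA, hAV⟩ := (Filter.mem_lift'_sets hg).1 hV
    obtain ⟨𝔶, h𝔶U, hA𝔶⟩ := Filter.frequently_iff.1 (h A hA) hU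
    exact ⟨𝔶, h𝔶U, hAV hA𝔶⟩
  obtain ⟨𝔛, h𝔛⟩ := Ultrafilter.exists_le (𝓕 ⊓ (𝔵 : Filter X).lift' g)
  exact ⟨𝔛, h𝔛.trans inf_le_left, Ultrafilter.coe_le_coe.1 fun A hA =>
    mem_ultraMul.2 (h𝔛.trans inf_le_right (Filter.mem_lift' hA))⟩

/-- The naturality squares of the multiplication are weak pullbacks. -/
theorem exists_ultraMul_eq_map_eq {f : X → Y} {𝔮 : Ultrafilter X}
    {𝔓 : Ultrafilter (Ultrafilter Y)} (h : ultraMul 𝔓 = 𝔮.map f) :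
    ∃ 𝔔 : Ultrafilter (Ultrafilter X), ultraMul 𝔔 = 𝔮 ∧ 𝔔.map (Ultrafilter.map f) = 𝔓 := by
  obtain ⟨𝔔, h𝔔, rfl⟩ : ∃ 𝔔 : Ultrafilter (Ultrafilter X),
      (𝔔 : Filter (Ultrafilter X)) ≤ Filter.comap (Ultrafilter.map f) 𝔓 ∧ ultraMul 𝔔 = 𝔮 := by
    refine exists_le_ultraMul_eq fun Q hQ => Filter.frequently_iff.2 ?_
    rintro 𝒰 ⟨𝒱, h𝒱, h𝒱𝒰⟩
    have hfQ : f '' Q ∈ ultraMul 𝔓 := h ▸ Filter.image_mem_map hQ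
    obtain ⟨𝔭, h𝔭, hfQ𝔭⟩ := 𝔓.nonempty_of_mem (Filter.inter_mem h𝒱 (mem_ultraMul.1 hfQ))
    refine ⟨Ultrafilter.ofComapInfPrincipal hfQ𝔭, h𝒱𝒰 ?_, Ultrafilter.ofComapInfPrincipal_mem hfQ𝔭⟩
    rwa [Set.mem_preimage, Ultrafilter.ofComapInfPrincipal_eq_of_map]
  exact ⟨𝔔, rfl, ultrafilter_map_eq_of_le (Filter.map_le_iff_le_comap.2 h𝔔)⟩

end UltraMul

section UltraExt

variable {X Y : Type w} {r : X → Y → ℝ≥0∞} {𝔵 : Ultrafilter X} {𝔶 : Ultrafilter Y} {t : ℝ≥0∞}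

theorem iInf_le_ultraExt {A : Set X} {B : Set Y} (hA : A ∈ 𝔵) (hB : B ∈ 𝔶) :
    ⨅ x ∈ A, ⨅ y ∈ B, r x y ≤ ultraExt r 𝔵 𝔶 :=
  (le_iSup₂ (f := fun B (_ : B ∈ 𝔶) => ⨅ x ∈ A, ⨅ y ∈ B, r x y) B hB).trans
    (le_iSup₂ (f := fun A (_ : A ∈ 𝔵) => ⨆ B ∈ 𝔶, ⨅ x ∈ A, ⨅ y ∈ B, r x y) A hA)

theorem exists_lt_of_ultraExt_lt (h : ultraExt r 𝔵 𝔶 < t) {A : Set X} {B : Set Y}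
    (hA : A ∈ 𝔵) (hB : B ∈ 𝔶) : ∃ x ∈ A, ∃ y ∈ B, r x y < t := by
  simpa only [iInf_lt_iff, exists_prop] using (iInf_le_ultraExt hA hB).trans_lt h

theorem exists_coupling_of_ultraExt_lt (h : ultraExt r 𝔵 𝔶 < t) :
    ∃ 𝔴 : Ultrafilter (X × Y), 𝔴.map Prod.fst = 𝔵 ∧ 𝔴.map Prod.snd = 𝔶 ∧
      ∀ᶠ z : X × Y in 𝔴, r z.1 z.2 < t := by
  refine exists_coupling (Filter.frequently_iff.2 fun {U} hU => ?_)
  obtain ⟨A, hA, B, hB, hAB⟩ := Filter.mem_prod_iff.1 hU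
  obtain ⟨x, hx, y, hy, hxy⟩ := exists_lt_of_ultraExt_lt h hA hB
  exact ⟨(x, y), hAB ⟨hx, hy⟩, hxy⟩

theorem ultraExt_map_map_le {S : Type*} {𝔰 : Ultrafilter S} {f : S → X} {g : S → Y}
    (h : ∀ᶠ s in 𝔰, r (f s) (g s) ≤ t) : ultraExt r (𝔰.map f) (𝔰.map g) ≤ t := by
  refine iSup₂_le fun A hA => iSup₂_le fun B hB => ?_
  obtain ⟨s, hs, hsA, hsB⟩ := 𝔰.nonempty_of_mem (Filter.inter_mem h (Filter.inter_mem hA hB))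
  exact (iInf₂_le (f s) hsA).trans ((iInf₂_le (g s) hsB).trans hs)

theorem ultraExt_map_map_le_ultraExt {X' Y' : Type w} (r : X → Y → ℝ≥0∞) (f : X' → X) (g : Y' → Y)
    (𝔵 : Ultrafilter X') (𝔶 : Ultrafilter Y') :
    ultraExt r (𝔵.map f) (𝔶.map g) ≤ ultraExt (fun x y => r (f x) (g y)) 𝔵 𝔶 := by
  refine iSup₂_le fun A hA => iSup₂_le fun B hB => le_trans ?_ (iInf_le_ultraExt hA hB)
  exact le_iInf₂ fun x hx => le_iInf₂ fun y hy =>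
    (iInf₂_le (f x) hx).trans (iInf₂_le (g y) hy)

theorem ultraExt_comp_left_le {X' : Type w} (r : X → Y → ℝ≥0∞) (f : X' → X) (𝔵 : Ultrafilter X')
    (𝔶 : Ultrafilter Y) : ultraExt (fun x => r (f x)) 𝔵 𝔶 ≤ ultraExt r (𝔵.map f) 𝔶 := by
  refine iSup₂_le fun A hA => iSup₂_le fun B hB => ?_
  simpa only [iInf_image] using
    iInf_le_ultraExt (r := r) (𝔵 := 𝔵.map f) (Filter.image_mem_map hA) hB

theorem ultraExt_ultraMul_map_le {S : Type*} {𝔰 : Ultrafilter S} {s : S → Ultrafilter Y}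
    (h : ∀ᶠ i in 𝔰, ultraExt r 𝔵 (s i) ≤ t) : ultraExt r 𝔵 (ultraMul (𝔰.map s)) ≤ t := by
  refine iSup₂_le fun A hA => iSup₂_le fun B hB => ?_
  obtain ⟨i, hi, hBi⟩ := 𝔰.nonempty_of_mem (Filter.inter_mem h (mem_ultraMul.1 hB))
  exact (iInf_le_ultraExt hA hBi).trans hi

end UltraExt

section Transitive

variable {X Y : Type w}

/-- The transitivity axiom for a numerical convergence relation `a : UX × X → [0,∞]`, which together
with reflexivity characterizes the ultrafilter convergences of approach spaces. -/
def IsTransitive (a : Ultrafilter X → X → ℝ≥0∞) : Prop :=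
  ∀ (𝔛 : Ultrafilter (Ultrafilter X)) (𝔵 : Ultrafilter X) (x : X),
    a (ultraMul 𝔛) x ≤ a 𝔵 x + ultraExt a 𝔛 𝔵

theorem IsTransitive.comap {a : Ultrafilter X → X → ℝ≥0∞} (ha : IsTransitive a) (k : Y → X) :
    IsTransitive fun 𝔶 y => a (𝔶.map k) (k y) := fun 𝔜 𝔶 y =>
  (ha (𝔜.map (Ultrafilter.map k)) (𝔶.map k) (k y)).trans
    (add_le_add_right (ultraExt_map_map_le_ultraExt a (Ultrafilter.map k) k 𝔜 𝔶) _)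

theorem IsTransitive.ultraMul_map_le {a : Ultrafilter X → X → ℝ≥0∞} (ha : IsTransitive a)
    {S : Type*} {𝔰 : Ultrafilter S} {s : S → Ultrafilter X} {g : S → X} {t : ℝ≥0∞}
    (h : ∀ᶠ i in 𝔰, a (s i) (g i) ≤ t) (x : X) :
    a (ultraMul (𝔰.map s)) x ≤ a (𝔰.map g) x + t :=
  (ha _ _ x).trans (add_le_add_right (ultraExt_map_map_le h) _)

end Transitive

section Conv

variable {X Y : Type w} [ApproachSpace X] [ApproachSpace Y]

theorem δ_le_conv {𝔵 : Ultrafilter X} {A : Set X} (hA : A ∈ 𝔵) (x : X) : δ A x ≤ conv 𝔵 x :=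
  le_iSup₂ (f := fun A (_ : A ∈ 𝔵) => δ A x) A hA

theorem exists_mem_conv_le_δ {A : Set X} (hA : A.Nonempty) (x : X) :
    ∃ 𝔵 : Ultrafilter X, A ∈ 𝔵 ∧ conv 𝔵 x ≤ δ A x := by
  obtain htop | htop := eq_top_or_lt_top (δ A x)
  · obtain ⟨y, hy⟩ := hA
    exact ⟨pure y, hy, htop ▸ le_top⟩
  -- An ultrafilter satisfies the bound as soon as it avoids every `C` with `δ A x < δ C x`.
  let 𝓕 : Filter X :=
    { sets := {B | δ A x < δ (A \ B) x}
      univ_sets := by simpa [δ_empty] using htop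
      sets_of_superset := fun {B C} (hB : _ < _) hBC =>
        hB.trans_le (δ_mono (Set.sdiff_subset_sdiff_right hBC) x)
      inter_sets := fun {B C} (hB : _ < _) (hC : _ < _) => by
        rw [Set.mem_ofPred_eq, Set.sdiff_inter, δ_union]
        exact lt_min hB hC }
  have hmem : ∀ B, B ∈ 𝓕 ↔ δ A x < δ (A \ B) x := fun _ => Iff.rfl
  have hne : 𝓕.NeBot := Filter.neBot_iff.2 fun h => by
    have := (hmem ∅).1 (h ▸ Filter.mem_bot)
    simp at this
  obtain ⟨𝔵, h𝔵⟩ := Ultrafilter.exists_le 𝓕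
  refine ⟨𝔵, h𝔵 ((hmem A).2 (by simpa [δ_empty] using htop)), iSup₂_le fun C hC => ?_⟩
  by_contra! hlt
  refine Ultrafilter.compl_notMem_iff.2 hC (h𝔵 ((hmem Cᶜ).2 ?_))
  rw [Set.sdiff_compl]
  exact hlt.trans_le (δ_mono Set.inter_subset_right x)

theorem conv_pure_self (x : X) : conv (pure x) x = 0 :=
  le_antisymm (iSup₂_le fun _ hA => (δ_of_mem (Ultrafilter.mem_pure.1 hA)).le) bot_le

theorem isTransitive_conv : IsTransitive (conv (X := X)) := fun 𝔛 𝔵 x => by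
  refine iSup₂_le fun A hA => le_add_of_forall_right_lt fun t ht => ?_
  have hB : {y | δ A y ≤ t} ∈ 𝔵 := by
    by_contra hB
    obtain ⟨𝔞, h𝔞, y, hy, hlt⟩ :=
      exists_lt_of_ultraExt_lt ht (mem_ultraMul.1 hA) (Ultrafilter.compl_mem_iff_notMem.2 hB)
    exact hy ((δ_le_conv h𝔞 y).trans hlt.le)
  exact (δ_enlarge A x t).trans (add_le_add_left (δ_le_conv hB x) t)

theorem isContraction_iff_conv {f : X → Y} :
    IsContraction f ↔ ∀ (𝔵 : Ultrafilter X) (x : X), conv (𝔵.map f) (f x) ≤ conv 𝔵 x := by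
  refine ⟨fun h 𝔵 x => iSup₂_le fun B hB => ?_, fun h A x => ?_⟩
  · exact (δ_mono (Set.image_preimage_subset f B) _).trans
      ((h _ x).trans (δ_le_conv (Ultrafilter.mem_map.1 hB) x))
  · obtain rfl | hA := A.eq_empty_or_nonempty
    · simp only [δ_empty, le_top]
    obtain ⟨𝔵, hA𝔵, hle⟩ := exists_mem_conv_le_δ hA x
    exact (δ_le_conv (𝔵 := 𝔵.map f) (Filter.image_mem_map hA𝔵) _).trans ((h 𝔵 x).trans hle)

theorem conv_prod (𝔴 : Ultrafilter (X × Y)) (p : X × Y) :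
    conv 𝔴 p = conv (𝔴.map Prod.fst) p.1 ⊔ conv (𝔴.map Prod.snd) p.2 := by
  refine le_antisymm (iSup₂_le fun A hA => iSup₂_le fun F hF => ?_)
    (sup_le (isContraction_iff_conv.1 isContraction_fst 𝔴 p)
      (isContraction_iff_conv.1 isContraction_snd 𝔴 p))
  obtain ⟨B, hB, hB𝔴⟩ : ∃ B ∈ F, B ∈ 𝔴 :=
    (Ultrafilter.finite_biUnion_mem_iff F.finite_toSet).1 (Filter.mem_of_superset hA hF)
  exact (iInf₂_le B hB).trans (max_le_max
    (δ_le_conv (𝔵 := 𝔴.map Prod.fst) (Filter.image_mem_map hB𝔴) _)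
    (δ_le_conv (𝔵 := 𝔴.map Prod.snd) (Filter.image_mem_map hB𝔴) _))

theorem isContraction_const (y : Y) : IsContraction (fun _ : X => y) := fun A x => by
  obtain rfl | ⟨z, hz⟩ := A.eq_empty_or_nonempty
  · simp only [δ_empty, le_top]
  · exact (δ_of_mem (Set.mem_image_of_mem _ hz)).trans_le bot_le

end Conv

section OfConv

variable {X : Type w}

/-- The approach space determined by a reflexive and transitive ultrafilter convergence. -/
noncomputable abbrev ofConv (a : Ultrafilter X → X → ℝ≥0∞) (refl : ∀ x, a (pure x) x = 0)
    (trans : IsTransitive a) : ApproachSpace X where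
  δ A x := ⨅ (𝔵 : Ultrafilter X) (_ : A ∈ 𝔵), a 𝔵 x
  δ_singleton x := le_antisymm ((iInf₂_le (pure x) (Set.mem_singleton x)).trans (refl x).le) bot_le
  δ_empty x := top_unique (le_iInf₂ fun 𝔵 h => absurd h 𝔵.empty_notMem)
  δ_union A B x := by
    simp only [Ultrafilter.union_mem_iff, iInf_or, iInf_inf_eq]
  δ_enlarge A x ε := by
    simp only [ENNReal.iInf_add]
    refine le_iInf₂ fun 𝔵 h𝔵 => le_add_of_forall_right_lt fun t ht => ?_
    have hex : ∀ᶠ y in 𝔵, ∃ 𝔞 : Ultrafilter X, A ∈ 𝔞 ∧ a 𝔞 y ≤ t := by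
      filter_upwards [h𝔵] with y hy
      obtain ⟨𝔞, hA, hlt⟩ : ∃ 𝔞 : Ultrafilter X, A ∈ 𝔞 ∧ a 𝔞 y < t := by
        simpa only [iInf_lt_iff, exists_prop] using lt_of_le_of_lt hy ht
      exact ⟨𝔞, hA, hlt.le⟩
    have : Nonempty (Ultrafilter X) := ⟨𝔵⟩
    obtain ⟨s, hs⟩ := hex.choice
    have hA : A ∈ ultraMul (𝔵.map s) := hs.mono fun _ h => h.1
    have hle : a (ultraMul (𝔵.map s)) x ≤ a 𝔵 x + t := by
      simpa only [Ultrafilter.map_id] using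
        trans.ultraMul_map_le (g := id) (hs.mono fun _ h => h.2) x
    exact (iInf₂_le (f := fun 𝔶 (_ : A ∈ 𝔶) => a 𝔶 x) _ hA).trans hle

theorem conv_ofConv (a : Ultrafilter X → X → ℝ≥0∞) (refl : ∀ x, a (pure x) x = 0)
    (trans : IsTransitive a) (𝔵 : Ultrafilter X) (x : X) :
    @conv X (ofConv a refl trans) 𝔵 x = a 𝔵 x := by
  let _ := ofConv a refl trans
  refine le_antisymm (iSup₂_le fun A hA => iInf₂_le 𝔵 hA)
    (le_of_forall_gt_imp_ge_of_dense fun t ht => ?_)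
  have hfreq : ∀ A ∈ 𝔵, ∃ᶠ 𝔶 in Filter.principal {𝔶 : Ultrafilter X | a 𝔶 x ≤ t}, A ∈ 𝔶 := by
    intro A hA
    have hlt : (⨅ (𝔶 : Ultrafilter X) (_ : A ∈ 𝔶), a 𝔶 x) < t := (δ_le_conv hA x).trans_lt ht
    obtain ⟨𝔶, hA𝔶, h𝔶⟩ : ∃ 𝔶 : Ultrafilter X, A ∈ 𝔶 ∧ a 𝔶 x < t := by
      simpa only [iInf_lt_iff, exists_prop] using hlt
    exact Filter.frequently_principal.2 ⟨𝔶, h𝔶.le, hA𝔶⟩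
  obtain ⟨𝔛, h𝔛, rfl⟩ := exists_le_ultraMul_eq hfreq
  have hconst : 𝔛.map (fun _ => x) = pure x := Ultrafilter.coe_injective Filter.map_const
  simpa only [Ultrafilter.map_id, hconst, refl, zero_add] using
    trans.ultraMul_map_le (s := id) (g := fun _ => x) (Filter.le_principal_iff.1 h𝔛) x

end OfConv

section Exponential

variable {X Y Z : Type w} [ApproachSpace X] [ApproachSpace Y] [ApproachSpace Z]

/-- The contractions from `X` to `Y`, the points of the exponential of `Y` by `X`. -/
abbrev Contraction (X Y : Type w) [ApproachSpace X] [ApproachSpace Y] : Type w :=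
  {h : X → Y // IsContraction h}

/-- The evaluation map of the exponential. -/
def eval (p : Contraction X Y × X) : Y := p.1.1 p.2

/-- The coarsest convergence on the set of contractions that makes evaluation a contraction: the
infimum of the distances `v` at which the convergence of `𝔭` to `h` is compatible with evaluation.
It is reflexive but in general not transitive. -/
noncomputable def expConv (𝔭 : Ultrafilter (Contraction X Y)) (h : Contraction X Y) : ℝ≥0∞ :=
  sInf {v | ∀ 𝔮 : Ultrafilter (Contraction X Y × X), 𝔮.map Prod.fst = 𝔭 → ∀ x,
    conv (𝔮.map eval) (h.1 x) ≤ v ⊔ conv (𝔮.map Prod.snd) x}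

theorem conv_map_eval_le (𝔮 : Ultrafilter (Contraction X Y × X)) (h : Contraction X Y) (x : X) :
    conv (𝔮.map eval) (h.1 x) ≤ expConv (𝔮.map Prod.fst) h ⊔ conv (𝔮.map Prod.snd) x := by
  refine le_of_forall_gt_imp_ge_of_dense fun t ht => ?_
  obtain ⟨v, hv, hvt⟩ := sInf_lt_iff.1 (le_sup_left.trans_lt ht)
  exact (hv 𝔮 rfl x).trans (sup_le hvt.le (le_sup_right.trans ht.le))

theorem expConv_pure (h : Contraction X Y) : expConv (pure h) h = 0 := by
  refine le_antisymm (sInf_le fun 𝔮 h𝔮 x => ?_) bot_le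
  rw [map_eq_of_map_fst_eq_pure h𝔮]
  exact (isContraction_iff_conv.1 h.2 _ x).trans le_sup_right

theorem expConv_map_le {S : Type*} {𝔰 : Ultrafilter S} {q : S → Contraction X Y}
    {k : Contraction X Y} {r : ℝ≥0∞}
    (h : ∀ 𝔴 : Ultrafilter (S × X), 𝔴.map Prod.fst = 𝔰 → ∀ x,
      conv (𝔴.map fun p => (q p.1).1 p.2) (k.1 x) ≤ r ⊔ conv (𝔴.map Prod.snd) x) :
    expConv (𝔰.map q) k ≤ r := by
  refine sInf_le fun 𝔮 h𝔮 x => ?_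
  obtain ⟨𝔠, rfl, rfl, hq⟩ := exists_coupling_of_map_eq h𝔮.symm
  have heval : (𝔠.map Prod.snd).map eval = 𝔠.map fun c => (q c.1).1 c.2.2 := by
    refine Ultrafilter.coe_injective (Filter.map_congr (hq.mono fun c hc => ?_))
    rw [hc, eval]
  simpa only [heval, Ultrafilter.map_map, Function.comp_def] using
    h (𝔠.map fun c => (c.1, c.2.2)) rfl x

theorem IsContraction.apply_left {g : Z × X → Y} (hg : IsContraction g) (z : Z) :
    IsContraction fun x => g (z, x) :=
  hg.comp ((isContraction_const z).prodMk isContraction_id)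

/-- The currying of a contraction `Z × X → Y`. -/
def curry (g : Z × X → Y) (hg : IsContraction g) (z : Z) : Contraction X Y :=
  ⟨fun x => g (z, x), hg.apply_left z⟩

theorem expConv_map_curry_le {g : Z × X → Y} (hg : IsContraction g) (𝔷 : Ultrafilter Z) (z : Z) :
    expConv (𝔷.map (curry g hg)) (curry g hg z) ≤ conv 𝔷 z := by
  refine expConv_map_le fun 𝔴 h𝔴 x => ?_
  rw [← h𝔴]
  exact (isContraction_iff_conv.1 hg 𝔴 (z, x)).trans_eq (conv_prod 𝔴 (z, x))

theorem isContraction_uncurry {k : Z → Contraction X Y}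
    (hk : ∀ (𝔷 : Ultrafilter Z) (z : Z), expConv (𝔷.map k) (k z) ≤ conv 𝔷 z) :
    IsContraction fun p : Z × X => (k p.1).1 p.2 := by
  refine isContraction_iff_conv.2 fun 𝔴 p => ?_
  rw [conv_prod]
  exact (conv_map_eval_le (𝔴.map (Prod.map k id)) (k p.1) p.2).trans
    (sup_le_sup_right (hk (𝔴.map Prod.fst) p.1) _)

theorem exists_map_eq_eventually_conv_eval_lt {𝔔 : Ultrafilter (Ultrafilter (Contraction X Y × X))}
    {𝔭 : Ultrafilter (Contraction X Y)} {𝔵 : Ultrafilter X} {t : ℝ≥0∞}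
    (h𝔭 : ultraExt expConv (𝔔.map (Ultrafilter.map Prod.fst)) 𝔭 < t)
    (h𝔵 : ultraExt conv (𝔔.map (Ultrafilter.map Prod.snd)) 𝔵 < t) :
    ∃ 𝔯 : Ultrafilter (Ultrafilter (Contraction X Y × X) × (Contraction X Y × X)),
      𝔯.map Prod.fst = 𝔔 ∧ (𝔯.map Prod.snd).map Prod.fst = 𝔭 ∧
      (𝔯.map Prod.snd).map Prod.snd = 𝔵 ∧
      ∀ᶠ c : Ultrafilter (Contraction X Y × X) × (Contraction X Y × X) in 𝔯,
        conv (c.1.map eval) (eval c.2) ≤ t := by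
  obtain ⟨𝔠, h𝔠, rfl, hp⟩ :=
    exists_coupling_of_ultraExt_lt ((ultraExt_comp_left_le _ _ _ _).trans_lt h𝔭)
  obtain ⟨𝔡, h𝔡, rfl, hx⟩ :=
    exists_coupling_of_ultraExt_lt ((ultraExt_comp_left_le _ _ _ _).trans_lt h𝔵)
  obtain ⟨𝔴, rfl, rfl, h𝔴⟩ := exists_coupling_of_map_eq (h𝔠.trans h𝔡.symm)
  refine ⟨𝔴.map fun c => (c.1.1, (c.1.2, c.2.2)), ?_, rfl, rfl, Filter.eventually_map.2 ?_⟩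
  · simpa only [Ultrafilter.map_map, Function.comp_def] using h𝔠
  filter_upwards [Filter.eventually_map.1 hp, Filter.eventually_map.1 hx, h𝔴] with c hcp hcx hc
  rw [← hc] at hcx
  exact (conv_map_eval_le c.1.1 c.1.2 c.2.2).trans (sup_le hcp.le hcx.le)

theorem isTransitive_expConv_of_iInf_le
    (hX : ∀ (𝔛 : Ultrafilter (Ultrafilter X)) (x₀ : X) (u v : ℝ≥0∞),
      ⨅ 𝔵 : Ultrafilter X, (u ⊔ conv 𝔵 x₀) + (v ⊔ ultraExt conv 𝔛 𝔵) ≤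
        (u + v) ⊔ conv (ultraMul 𝔛) x₀) :
    IsTransitive (expConv (X := X) (Y := Y)) := fun 𝔓 𝔭 h => by
  refine sInf_le fun 𝔮 h𝔮 x => ?_
  obtain ⟨𝔔, rfl, rfl⟩ := exists_ultraMul_eq_map_eq h𝔮.symm
  refine le_trans (le_iInf fun 𝔵 => le_add_of_forall_right_lt fun t ht => ?_)
    (hX (𝔔.map (Ultrafilter.map Prod.snd)) x _ _)
  obtain ⟨𝔯, rfl, rfl, rfl, h𝔯⟩ :=
    exists_map_eq_eventually_conv_eval_lt (le_sup_left.trans_lt ht) (le_sup_right.trans_lt ht)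
  calc conv ((ultraMul (𝔯.map Prod.fst)).map eval) (h.1 x)
      ≤ conv ((𝔯.map Prod.snd).map eval) (h.1 x) + t := by
        rw [← ultraMul_map, Ultrafilter.map_map, Ultrafilter.map_map]
        exact isTransitive_conv.ultraMul_map_le h𝔯 _
    _ ≤ _ := add_le_add_left (conv_map_eval_le _ h x) t

end Exponential

end ApproachSpace

namespace AppCat

section Sufficiency

variable {X : Type w} [ApproachSpace X]

/-- The exponential of `Y` by `X`, available when `expConv` is transitive. -/
noncomputable def exp (Y : AppCat.{w}) (h : IsTransitive (expConv (X := X) (Y := Y.carrier))) :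
    AppCat.{w} :=
  @of (Contraction X Y.carrier) (ofConv expConv expConv_pure h)

theorem conv_exp {Y : AppCat.{w}} (h : IsTransitive (expConv (X := X) (Y := Y.carrier)))
    (𝔭 : Ultrafilter (Contraction X Y.carrier)) (k : Contraction X Y.carrier) :
    conv (X := (exp Y h).carrier) 𝔭 k = expConv 𝔭 k :=
  conv_ofConv expConv expConv_pure h 𝔭 k

/-- Currying as a bijection between the maps `Z × X ⟶ Y` and the maps `Z ⟶ exp Y`. -/
noncomputable def curryEquiv (Z Y : AppCat.{w})
    (h : IsTransitive (expConv (X := X) (Y := Y.carrier))) :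
    ((prodFunctor (of X)).obj Z ⟶ Y) ≃ (Z ⟶ exp Y h) where
  toFun g := ⟨curry g.toFun g.contraction, isContraction_iff_conv.2 fun 𝔷 z =>
    (conv_exp h _ _).trans_le (expConv_map_curry_le g.contraction 𝔷 z)⟩
  invFun k := ⟨fun p => (k.toFun p.1 : Contraction X Y.carrier).1 p.2,
    isContraction_uncurry (k := k.toFun) fun 𝔷 z => (conv_exp h _ _).symm.trans_le
      (isContraction_iff_conv.1 k.contraction 𝔷 z)⟩
  left_inv _ := rfl
  right_inv _ := rfl

theorem isExponentiable_of_isTransitive_expConv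
    (h : ∀ Y : AppCat.{w}, IsTransitive (expConv (X := X) (Y := Y.carrier))) :
    IsExponentiable (of X) :=
  (Adjunction.adjunctionOfEquivRight (fun Z Y => curryEquiv Z Y (h Y))
    (fun _ _ _ _ _ => rfl)).isLeftAdjoint

end Sufficiency

end AppCat

namespace ApproachSpace

section SingleLimit

variable {S X Y : Type w}

open Classical in
/-- The finest approach structure on a set in which the ultrafilter `𝔰` converges to `s₀` at
distance at most `r`. -/
noncomputable abbrev singleLimit (𝔰 : Ultrafilter S) (s₀ : S) (r : ℝ≥0∞) : ApproachSpace S where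
  δ A s := if s ∈ A then 0 else if s = s₀ ∧ A ∈ 𝔰 then r else ∞
  δ_singleton s := if_pos (Set.mem_singleton s)
  δ_empty s := by simp
  δ_union A B s := by
    simp only [Set.mem_union, Ultrafilter.union_mem_iff]
    by_cases hA : s ∈ A <;> by_cases hB : s ∈ B <;> by_cases hs : s = s₀ <;>
      by_cases hA𝔰 : A ∈ 𝔰 <;> by_cases hB𝔰 : B ∈ 𝔰 <;> simp_all
  δ_enlarge A s ε := by
    obtain rfl | hε := eq_or_ne ε ∞
    · simp
    set A' := {y | (if y ∈ A then 0 else if y = s₀ ∧ A ∈ 𝔰 then r else ∞) ≤ ε} with hA'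
    by_cases hs : s ∈ A'
    · exact le_add_left hs
    have hAA' : A ⊆ A' := fun y hy => by simp [hA', hy]
    rw [if_neg hs, if_neg fun h => hs (hAA' h)]
    refine le_add_right ?_
    by_cases hlim : s = s₀ ∧ A' ∈ 𝔰
    · have hA'A : A' ⊆ A := fun y hy => by
        by_contra hyA
        have hys₀ : y = s₀ := by
          by_contra hys
          simp [hA', hyA, hys, hε] at hy
        exact hs (hlim.1.trans hys₀.symm ▸ hy)
      rw [if_pos hlim, if_pos ⟨hlim.1, Filter.mem_of_superset hlim.2 hA'A⟩]
    · rw [if_neg hlim]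
      exact le_top

open Classical in
theorem conv_singleLimit (𝔰 : Ultrafilter S) (s₀ : S) (r : ℝ≥0∞) (𝔷 : Ultrafilter S) (z : S) :
    @conv S (singleLimit 𝔰 s₀ r) 𝔷 z =
      if 𝔷 = pure z then 0 else if 𝔷 = 𝔰 ∧ z = s₀ then r else ∞ := by
  let _ := singleLimit 𝔰 s₀ r
  have hδ : ∀ A : Set S, z ∉ A → δ A z = if z = s₀ ∧ A ∈ 𝔰 then r else ∞ :=
    fun _ hA => if_neg hA
  obtain rfl | hz := eq_or_ne 𝔷 (pure z)
  · rw [if_pos rfl, conv_pure_self]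
  rw [if_neg hz]
  have hcompl : {z}ᶜ ∈ 𝔷 := Ultrafilter.compl_mem_iff_notMem.2 fun h =>
    hz (Ultrafilter.coe_le_coe.1 (Filter.le_pure_iff.2 h))
  split_ifs with hlim
  · obtain ⟨rfl, rfl⟩ := hlim
    refine le_antisymm (iSup₂_le fun A hA => ?_) ?_
    · by_cases hzA : z ∈ A
      · exact (δ_of_mem hzA).trans_le bot_le
      · rw [hδ A hzA, if_pos ⟨rfl, hA⟩]
    · simpa [hδ, hcompl] using δ_le_conv hcompl z
  · obtain ⟨B, hB, hB𝔰⟩ : ∃ B ∈ 𝔷, ¬(z = s₀ ∧ B ∈ 𝔰) := by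
      by_contra! h
      exact hlim ⟨(Ultrafilter.coe_le_coe.1 fun B hB => (h B hB).2).symm, (h _ hcompl).1⟩
    refine top_unique (le_trans ?_ (δ_le_conv (Filter.inter_mem hB hcompl) z))
    rw [hδ _ (by simp), if_neg fun h => hB𝔰 ⟨h.1, Filter.mem_of_superset h.2 Set.inter_subset_left⟩]

theorem isContraction_singleLimit_prod [ApproachSpace X] [ApproachSpace Y] {𝔰 : Ultrafilter S}
    {s₀ : S} {r : ℝ≥0∞} {f : S × X → Y} (hf : ∀ s, IsContraction fun x => f (s, x))
    (h : ∀ 𝔴 : Ultrafilter (S × X), 𝔴.map Prod.fst = 𝔰 → ∀ x,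
      conv (𝔴.map f) (f (s₀, x)) ≤ r ⊔ conv (𝔴.map Prod.snd) x) :
    @IsContraction _ _ (@prod _ _ (singleLimit 𝔰 s₀ r) _) _ f := by
  classical
  let _ := singleLimit 𝔰 s₀ r
  refine isContraction_iff_conv.2 fun 𝔴 ⟨s, x⟩ => ?_
  rw [conv_prod, conv_singleLimit]
  split_ifs with hpure hlim
  · rw [map_eq_of_map_fst_eq_pure hpure]
    exact (isContraction_iff_conv.1 (hf s) _ x).trans le_sup_right
  · obtain ⟨h𝔴, rfl⟩ := hlim
    exact h 𝔴 h𝔴 x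
  · simp

end SingleLimit

end ApproachSpace

namespace AppCat

section Representation

variable {X : Type w} [ApproachSpace X]

theorem IsExponentiable.exists_eval (hX : IsExponentiable (of X)) (Y : AppCat.{w}) :
    ∃ (E : AppCat.{w}) (ev : E.carrier × X → Y.carrier), IsContraction ev ∧
      (∀ e e', (∀ x, ev (e, x) = ev (e', x)) → e = e') ∧
      ∀ (Z : AppCat.{w}) (g : Z.carrier × X → Y.carrier), IsContraction g →
        ∃ k : Z.carrier → E.carrier, IsContraction k ∧ ∀ z x, ev (k z, x) = g (z, x) := by
  obtain ⟨G, ⟨adj⟩⟩ := hX.exists_rightAdjoint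
  have heval : ∀ (Z : AppCat.{w}) (k : Z ⟶ G.obj Y) (p : Z.carrier × X),
      ((adj.homEquiv Z Y).symm k).toFun p = (adj.counit.app Y).toFun (k.toFun p.1, p.2) :=
    fun Z k p => by rw [Adjunction.homEquiv_counit]; rfl
  refine ⟨G.obj Y, (adj.counit.app Y).toFun, (adj.counit.app Y).contraction, fun e e' h => ?_,
    fun Z g hg => ?_⟩
  · let const : (G.obj Y).carrier → (G.obj Y ⟶ G.obj Y) := fun e => ⟨_, isContraction_const e⟩
    have hconst : const e = const e' := (adj.homEquiv _ Y).symm.injective <| hom_ext fun p =>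
      (heval _ (const e) p).trans ((h p.2).trans (heval _ (const e') p).symm)
    exact congrArg (fun k => k.toFun e) hconst
  · let k := adj.homEquiv Z Y ⟨g, hg⟩
    refine ⟨k.toFun, k.contraction, fun z x => ?_⟩
    rw [← heval Z k (z, x), Equiv.symm_apply_apply]

theorem IsExponentiable.exists_conv_map_eq_expConv (hX : IsExponentiable (of X))
    (Y : AppCat.{w}) :
    ∃ (E : AppCat.{w}) (k : Contraction X Y.carrier → E.carrier),
      ∀ 𝔭 h, conv (𝔭.map k) (k h) = expConv 𝔭 h := by
  obtain ⟨E, ev, hev, hinj, hcurry⟩ := hX.exists_eval Y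
  have htest : ∀ (𝔭 : Ultrafilter (Contraction X Y.carrier)) (h : Contraction X Y.carrier),
      ∃ k : Contraction X Y.carrier → E.carrier,
        conv (𝔭.map k) (k h) ≤ expConv 𝔭 h ∧ ∀ c x, ev (k c, x) = c.1 x := by
    intro 𝔭 h
    let _ := singleLimit 𝔭 h (expConv 𝔭 h)
    obtain ⟨k, hk, hkev⟩ := hcurry (of (Contraction X Y.carrier)) eval
      (isContraction_singleLimit_prod (fun c => c.2) fun 𝔴 h𝔴 x => h𝔴 ▸ conv_map_eval_le 𝔴 h x)
    refine ⟨k, (isContraction_iff_conv.1 hk 𝔭 h).trans ?_, hkev⟩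
    classical
    rw [conv_singleLimit]
    split_ifs <;> simp_all
  choose k' hk' hev' using htest
  let k : Contraction X Y.carrier → E.carrier := fun h => k' (pure h) h h
  have hk : ∀ 𝔭 h, k' 𝔭 h = k := fun 𝔭 h => funext fun c =>
    hinj _ _ fun x => (hev' 𝔭 h c x).trans (hev' (pure c) c c x).symm
  refine ⟨E, k, fun 𝔭 h => le_antisymm (hk 𝔭 h ▸ hk' 𝔭 h) ?_⟩
  have hcurryk : ∀ c, curry ev hev (k c) = c := fun c => Subtype.ext (funext (hev' (pure c) c c))
  have hid : curry ev hev ∘ k = id := funext hcurryk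
  simpa only [Ultrafilter.map_map, hid, Ultrafilter.map_id, hcurryk] using
    expConv_map_curry_le hev (𝔭.map k) (k h)

theorem IsExponentiable.isTransitive_expConv (hX : IsExponentiable (of X)) (Y : AppCat.{w}) :
    IsTransitive (expConv (X := X) (Y := Y.carrier)) := by
  obtain ⟨E, k, hk⟩ := hX.exists_conv_map_eq_expConv Y
  simpa only [hk] using (isTransitive_conv (X := E.carrier)).comap k

end Representation

end AppCat

namespace ApproachSpace

section ExtendedReals

/-- The approach structure of `[0,∞]` for which the contractions into it are the functions `f` with
`f x ≤ δ (A, x) + sup f(A)` for nonempty `A`. The space is lifted to the universe of `X`. -/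
noncomputable instance : ApproachSpace (ULift.{w} ℝ≥0∞) where
  δ A y := ⨅ _ : A.Nonempty, y.down - ⨆ a ∈ A, a.down
  δ_singleton y := by simp
  δ_empty y := by simp
  δ_union A B y := by
    obtain rfl | hA := A.eq_empty_or_nonempty
    · simp
    obtain rfl | hB := B.eq_empty_or_nonempty
    · simp
    simp only [hA, hB, hA.inl, iInf_pos, iSup_union]
    have hanti : Antitone fun t : ℝ≥0∞ => y.down - t := fun _ _ h => tsub_le_tsub_left h _
    exact hanti.map_sup _ _
  δ_enlarge A y ε := by
    obtain rfl | hA := A.eq_empty_or_nonempty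
    · by_cases hε : ε = ∞ <;> simp [hε]
    simp only [hA, iInf_pos]
    rw [ENNReal.iInf_add]
    refine le_iInf fun _ => tsub_le_iff_right.2 ?_
    have hsup : ⨆ a ∈ {z : ULift.{w} ℝ≥0∞ | z.down - ⨆ a ∈ A, a.down ≤ ε}, a.down ≤
        ε + ⨆ a ∈ A, a.down := iSup₂_le fun a ha => tsub_le_iff_right.1 ha
    rw [add_assoc]
    exact le_tsub_add.trans (add_le_add_right hsup _)

theorem conv_ulift_le_iff {𝔳 : Ultrafilter (ULift.{w} ℝ≥0∞)} {y : ULift.{w} ℝ≥0∞} {s : ℝ≥0∞} :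
    conv 𝔳 y ≤ s ↔ ∀ t, (∀ᶠ a : ULift.{w} ℝ≥0∞ in 𝔳, a.down ≤ t) → y.down ≤ s + t := by
  refine ⟨fun h t ht => ?_, fun h => iSup₂_le fun A hA => ?_⟩
  · have hsup : ⨆ a ∈ {a : ULift.{w} ℝ≥0∞ | a.down ≤ t}, a.down ≤ t := iSup₂_le fun _ ha => ha
    have hle : y.down - t ≤ δ {a | a.down ≤ t} y := le_iInf fun _ => tsub_le_tsub_left hsup _
    exact tsub_le_iff_right.1 (hle.trans ((δ_le_conv ht y).trans h))
  · refine (iInf_le _ (𝔳.nonempty_of_mem hA)).trans (tsub_le_iff_right.2 (h _ ?_))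
    filter_upwards [hA] with a ha using le_iSup₂ (f := fun a (_ : a ∈ A) => a.down) a ha

variable {X : Type w} [ApproachSpace X]

theorem isContraction_ulift_iff {f : X → ULift.{w} ℝ≥0∞} :
    IsContraction f ↔ ∀ (𝔵 : Ultrafilter X) (x : X) (t : ℝ≥0∞),
      (∀ᶠ y in 𝔵, (f y).down ≤ t) → (f x).down ≤ conv 𝔵 x + t := by
  simp only [isContraction_iff_conv, conv_ulift_le_iff, Ultrafilter.coe_map, Filter.eventually_map]

theorem exists_add_le_tendsto {S : Type*} {𝔰 : Ultrafilter S} {f g : S → ℝ≥0∞} {t : ℝ≥0∞}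
    (h : ∀ᶠ i in 𝔰, f i + g i ≤ t) :
    ∃ α β, α + β ≤ t ∧ Filter.Tendsto f 𝔰 (nhds α) ∧ Filter.Tendsto g 𝔰 (nhds β) := by
  have hf : Filter.Tendsto f 𝔰 (nhds (𝔰.map f).lim) := (𝔰.map f).le_nhds_lim
  have hg : Filter.Tendsto g 𝔰 (nhds (𝔰.map g).lim) := (𝔰.map g).le_nhds_lim
  exact ⟨_, _, le_of_tendsto (hf.add hg) h, hf, hg⟩

/-- The contraction `y ↦ v ∨ a (𝔞, y)` from `X` to `[0,∞]`. -/
noncomputable def supConv (v : ℝ≥0∞) (𝔞 : Ultrafilter X) : Contraction X (ULift.{w} ℝ≥0∞) :=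
  ⟨fun y => ⟨v ⊔ conv 𝔞 y⟩, isContraction_ulift_iff.2 fun 𝔶 y t ht => by
    obtain ⟨z, hz⟩ := ht.exists
    have hconv := isTransitive_conv.ultraMul_map_le (s := fun _ => 𝔞) (g := id)
      (ht.mono fun _ h => le_sup_right.trans h) y
    rw [ultraMul_map_const, Ultrafilter.map_id] at hconv
    exact sup_le (le_add_left (le_sup_left.trans hz)) hconv⟩

theorem iInf_add_ultraExt_le {𝔛 : Ultrafilter (Ultrafilter X)} {u v : ℝ≥0∞} {𝔶 : Ultrafilter X}
    {s : X → Ultrafilter X} {t : ℝ≥0∞}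
    (hs : ∀ᶠ z in 𝔶, (u ⊔ conv (s z) z) + (v ⊔ ultraExt conv 𝔛 (s z)) ≤ t) (y : X) :
    ⨅ 𝔵, (u ⊔ conv 𝔵 y) + (v ⊔ ultraExt conv 𝔛 𝔵) ≤ conv 𝔶 y + t := by
  obtain ⟨α, β, hαβ, hα, hβ⟩ := exists_add_le_tendsto hs
  have huα : u ≤ α := ge_of_tendsto' hα fun _ => le_sup_left
  have hvβ : v ≤ β := ge_of_tendsto' hβ fun _ => le_sup_left
  have hconv : conv (ultraMul (𝔶.map s)) y ≤ conv 𝔶 y + α :=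
    le_add_of_forall_right_lt fun α' hα' => by
      simpa only [Ultrafilter.map_id] using isTransitive_conv.ultraMul_map_le (g := id)
        ((hα.eventually_lt_const hα').mono fun _ h => le_sup_right.trans h.le) y
  have hext : ultraExt conv 𝔛 (ultraMul (𝔶.map s)) ≤ β :=
    le_of_forall_gt_imp_ge_of_dense fun β' hβ' => ultraExt_ultraMul_map_le
      ((hβ.eventually_lt_const hβ').mono fun _ h => le_sup_right.trans h.le)
  calc ⨅ 𝔵, (u ⊔ conv 𝔵 y) + (v ⊔ ultraExt conv 𝔛 𝔵)
      ≤ (u ⊔ conv (ultraMul (𝔶.map s)) y) + (v ⊔ ultraExt conv 𝔛 (ultraMul (𝔶.map s))) :=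
        iInf_le _ _
    _ ≤ (conv 𝔶 y + α) + β :=
        add_le_add (sup_le (le_add_left huα) hconv) (sup_le hvβ hext)
    _ ≤ conv 𝔶 y + t := by
        rw [add_assoc]
        exact add_le_add_right hαβ _

/-- The contraction `y ↦ inf_𝔵 ((u ∨ a (𝔵, y)) + (v ∨ Ū a (𝔛, 𝔵)))` from `X` to `[0,∞]`. -/
noncomputable def infConv (𝔛 : Ultrafilter (Ultrafilter X)) (u v : ℝ≥0∞) :
    Contraction X (ULift.{w} ℝ≥0∞) :=
  ⟨fun y => ⟨⨅ 𝔵, (u ⊔ conv 𝔵 y) + (v ⊔ ultraExt conv 𝔛 𝔵)⟩,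
    isContraction_ulift_iff.2 fun 𝔶 y t ht => le_add_of_forall_right_lt fun t' ht' => by
      have hex : ∀ᶠ z in 𝔶, ∃ 𝔵, (u ⊔ conv 𝔵 z) + (v ⊔ ultraExt conv 𝔛 𝔵) ≤ t' :=
        ht.mono fun z hz => (iInf_lt_iff.1 (hz.trans_lt ht')).imp fun _ h => h.le
      have : Nonempty (Ultrafilter X) := ⟨𝔶⟩
      obtain ⟨s, hs⟩ := hex.choice
      exact iInf_add_ultraExt_le hs y⟩

theorem expConv_map_supConv_pure_le (v : ℝ≥0∞) (𝔞 : Ultrafilter X) :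
    expConv (𝔞.map fun x => supConv 0 (pure x)) (supConv v 𝔞) ≤ v := by
  refine expConv_map_le fun 𝔴 h𝔴 y => conv_ulift_le_iff.2 fun t ht => ?_
  have hmul : ultraMul (𝔴.map fun p => pure p.1) = 𝔞 := h𝔴 ▸ Ultrafilter.ext fun _ => Iff.rfl
  have hconv : conv 𝔞 y ≤ conv (𝔴.map Prod.snd) y + t := hmul ▸
    isTransitive_conv.ultraMul_map_le
      ((Filter.eventually_map.1 ht).mono fun _ h => le_sup_right.trans h) y
  exact sup_le (le_add_right le_sup_left) (hconv.trans (add_le_add_left le_sup_right t))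

theorem expConv_map_supConv_le (𝔛 : Ultrafilter (Ultrafilter X)) (u v : ℝ≥0∞) :
    expConv (𝔛.map (supConv v)) (infConv 𝔛 u v) ≤ u := by
  refine expConv_map_le fun 𝔴 h𝔴 y => conv_ulift_le_iff.2 fun t ht => ?_
  have ht𝔴 : ∀ᶠ p : Ultrafilter X × X in 𝔴, v ⊔ conv p.1 p.2 ≤ t := Filter.eventually_map.1 ht
  obtain ⟨p, hp⟩ := ht𝔴.exists
  have hext : ultraExt conv 𝔛 (𝔴.map Prod.snd) ≤ t :=
    h𝔴 ▸ ultraExt_map_map_le (ht𝔴.mono fun _ h => le_sup_right.trans h)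
  exact (iInf_le _ (𝔴.map Prod.snd)).trans
    (add_le_add_right (sup_le (le_sup_left.trans hp) hext) _)

theorem iInf_le_of_isTransitive_expConv
    (h : IsTransitive (expConv (X := X) (Y := ULift.{w} ℝ≥0∞)))
    (𝔛 : Ultrafilter (Ultrafilter X)) (x₀ : X) (u v : ℝ≥0∞) :
    ⨅ 𝔵, (u ⊔ conv 𝔵 x₀) + (v ⊔ ultraExt conv 𝔛 𝔵) ≤ (u + v) ⊔ conv (ultraMul 𝔛) x₀ := by
  let q : X → Contraction X (ULift.{w} ℝ≥0∞) := fun x => supConv 0 (pure x)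
  have hexp : expConv ((ultraMul 𝔛).map q) (infConv 𝔛 u v) ≤ u + v := by
    rw [← ultraMul_map]
    exact (h.ultraMul_map_le (.of_forall (expConv_map_supConv_pure_le v)) _).trans
      (add_le_add_left (expConv_map_supConv_le 𝔛 u v) v)
  have heval := conv_map_eval_le ((ultraMul 𝔛).map fun x => (q x, x)) (infConv 𝔛 u v) x₀
  have hdiag : ∀ x, (eval (q x, x)).down = 0 := fun x => by simp [eval, q, supConv, conv_pure_self]
  have hle := conv_ulift_le_iff.1 heval 0
    (Filter.eventually_map.2 (Filter.eventually_map.2 (.of_forall fun x => (hdiag x).le)))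
  rw [add_zero] at hle
  exact hle.trans (sup_le_sup_right hexp _)

end ExtendedReals

end ApproachSpace

theorem theorem5p1 {X : Type*} [ApproachSpace X] :
    AppCat.IsExponentiable (AppCat.of X) ↔
      ∀ (𝔛 : Ultrafilter (Ultrafilter X)) (x₀ : X) (u v : ℝ≥0∞),
        (u + v) ⊔ ApproachSpace.conv (ApproachSpace.ultraMul 𝔛) x₀ ≥
          ⨅ 𝔵 : Ultrafilter X, (u ⊔ ApproachSpace.conv 𝔵 x₀) +
            (v ⊔ ApproachSpace.ultraExt ApproachSpace.conv 𝔛 𝔵) :=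
  ⟨fun hX => iInf_le_of_isTransitive_expConv (hX.isTransitive_expConv (.of _)),
    fun h => AppCat.isExponentiable_of_isTransitive_expConv fun _ =>
      isTransitive_expConv_of_iInf_le h⟩
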